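/- Let $N\cong\mathbb Z^n$ with $n\ge 2$. A tropical curve $h\colon\Gamma\to N_{\mathbb R}$ consists of a finite connected graph $\Gamma$ with bounded and unbounded edges (each unbounded edge having one end vertex), positive integer weights $w(E)$, and a proper map $h$ sending vertices to $N_{\mathbb Q}$ and edges affinely to segments or half-lines of rational slope such that at each vertex $V$ the balancing condition $\sum_{E\ni V}w(E)\,u_{(V,E)}=0$ holds, where $u_{(V,E)}\in N$ is the primitive vector along $h(E)$ emanating from $h(V)$. Vertices of any valence, including $2$, are allowed. Let $(\Gamma,h)$ be an *embedded* tropical curve ($h$ is injective) which is *non-superabundant*: if $L^{[1]}$ is the set of edges of the loop part of $\Gamma$ (the bounded edges whose removal lowers the first Betti number), oriented arbitrarily, and $u_E$ is the primitive vector of $E\in L^{[1]}$, then the abundancy map $$\mathbb R^{L^{[1]}}\to \operatorname{Hom}(H_1(\Gamma),N_{\mathbb R}),\qquad (\ell_E)\mapsto\Big(\sum_E a_E[E]\mapsto\sum_E \ell_E a_E u_E\Big)$$ is surjective. Let $\mathscr P$ be an integral polyhedral decomposition of $N_{\mathbb R}$ (finitely many strongly convex rational polyhedra covering $N_{\mathbb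 R}$, closed under faces and meeting along common faces, with all vertices in $N$) respecting $(\Gamma,h)$: after rescaling $h$ by some positive integer (and inserting $2$-valent vertices in $\Gamma$ where necessary), $h(\Gamma)$ is contained in the $1$-skeleton of $\mathscr P$ and $h^{-1}(\mathscr P^{[0]})=\Gamma^{[0]}$. Let $\mathfrak X\to\mathbb C$ be the corresponding toric degeneration, that is, the toric variety of the fan in $N_{\mathbb R}\times\mathbb R$ formed by the closures of the cones over $\Xi\times\{1\}$, $\Xi\in\mathscr P$, and their faces at height $0$, with the projection given by the last coordinate. Let $X_0=\bigcup_{v\in\mathscr P^{[0]}}X_v$ be its central fiber, where $X_v$ is the toric variety of the fan of tangent cones at $v$ of the cells containing $v$. A map $\mathbb P^1\to X_v$ is *torically transverse* if it is holomorphic, misses all toric strata of codimension $>1$, and the preimage of the big torus is dense. For a vertex $V$ of $\Gamma$ with $h(V)=v$, it is *of type $V$*, with marked points $(p_E)_{E\ni V}$, if it is non-constant and torically transverse, the $p_E$ are distinct, it meets at $p_E$ the toric divisor of the ray $\mathbb R_{\ge0}u_{(V,E)}$ with multiplicity $w(E)$, and it meets no toric divisor at any other point. A *pre-log curve* is a stable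 map $\varphi_0\colon C_0\to X_0$ from a prestable (connected nodal) curve whose restriction over each $X_v$ is torically transverse, such that each point of $C_0$ mapped to the singular locus of $X_0$ is a node whose two branches are mapped to different components of $X_0$, with equal intersection indices with the toric divisors through the image point. It is *of type $(\Gamma,h)$* if its components are rational curves $(C_V)_{V\in\Gamma^{[0]}}$, with $\varphi_0|_{C_V}$ mapping to $X_{h(V)}$ and of type $V$, and if $\Gamma$ is its dual intersection graph: the nodes correspond to the bounded edges, the node of an edge $E$ with ends $V,V'$ joining the marked points of $C_V$ and $C_{V'}$ which belong to $E$. Then, for every choice of rational curves $C_{0,V}\to X_{h(V)}$ of type $V$, one for each vertex $V$ of $\Gamma$, there is a pre-log curve $\varphi_0\colon C_0\to X_0$ of type $(\Gamma,h)$ whose component corresponding to $V$ is, for each $V$, isomorphic to $C_{0,V}$ as a rational curve with marked points (labelled by the edges emanating from $V$). -/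

import Mathlib

open scoped Topology

noncomputable section

namespace TropicalPreLog

/-! ## Lattice conventions

`N = ℤ^ι`, `N_ℝ = ℝ^ι`, and the dual lattice `M = Hom(N, ℤ)` is again written as `ℤ^ι`. -/

/-- The pairing of an element of the dual lattice with a real vector. -/
def pairing {ι : Type} [Fintype ι] (m : ι → ℤ) (x : ι → ℝ) : ℝ := ∑ i, (m i : ℝ) * x i

/-- An integral vector, seen as a real vector. -/
def realVec {ι : Type} (u : ι → ℤ) : ι → ℝ := fun i => (u i : ℝ)

/-- A primitive integral vector: it is not a proper integral multiple (in particular not `0`). -/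
def IsPrimitive {ι : Type} (u : ι → ℤ) : Prop := ∀ (k : ℤ) (v : ι → ℤ), u = k • v → IsUnit k

/-- The ray `ℝ_{≥ 0} u`. -/
def rayCone {ι : Type} (u : ι → ℤ) : Set (ι → ℝ) := {x | ∃ t : ℝ, 0 ≤ t ∧ x = t • realVec u}

/-! ## Tropical curves -/

/-- A finite weighted graph. `V` is the set of vertices, `B` the set of bounded edges
(with an auxiliary orientation from `src` to `tgt`; multiple edges and self-loops are allowed),
and `U` the set of unbounded edges, each of which has exactly one end vertex. -/
structure WeightedGraph where
  V : Type
  B : Type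
  U : Type
  finV : Fintype V
  finB : Fintype B
  finU : Fintype U
  src : B → V
  tgt : B → V
  base : U → V
  weightB : B → ℕ
  weightU : U → ℕ
  weightB_pos : ∀ E, 0 < weightB E
  weightU_pos : ∀ E, 0 < weightU E

attribute [instance] WeightedGraph.finV WeightedGraph.finB WeightedGraph.finU

namespace WeightedGraph

variable (G : WeightedGraph)

/-- The graph is non-empty and connected. -/
def IsConnected : Prop :=
  Nonempty G.V ∧
    ∀ x y : G.V, Relation.EqvGen (fun a b => ∃ E : G.B, G.src E = a ∧ G.tgt E = b) x y

/-- A flag, that is an edge together with one of its ends: `(E, false)` is the bounded edge `E`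
at `src E`, `(E, true)` is the bounded edge `E` at `tgt E`, and an unbounded edge gives one flag. -/
abbrev Flag : Type := (G.B × Bool) ⊕ G.U

/-- The vertex of a flag. -/
def flagVertex : G.Flag → G.V
  | Sum.inl (E, false) => G.src E
  | Sum.inl (E, true) => G.tgt E
  | Sum.inr E => G.base E

/-- The weight of the edge of a flag. -/
def flagWeight : G.Flag → ℕ
  | Sum.inl (E, _) => G.weightB E
  | Sum.inr E => G.weightU E

/-- The flags at a vertex, that is the edges emanating from it. -/
abbrev FlagAt (v : G.V) : Type := {f : G.Flag // G.flagVertex f = v}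

open Classical in
/-- The simplicial boundary map from 1-chains to 0-chains. -/
def boundary : (G.B → ℤ) →ₗ[ℤ] (G.V → ℤ) :=
  ∑ E : G.B, (LinearMap.proj E : (G.B → ℤ) →ₗ[ℤ] ℤ).smulRight
    (Pi.single (G.tgt E) (1 : ℤ) - Pi.single (G.src E) (1 : ℤ) : G.V → ℤ)

/-- `H_1(Γ)`: the simplicial 1-cycles. (There are no 2-simplices, and unbounded edges do not
contribute to the homology.) -/
def H1 : Submodule ℤ (G.B → ℤ) := LinearMap.ker G.boundary

/-- The first Betti number. -/
def betti : ℕ := Module.finrank ℤ G.H1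

open Classical in
/-- The graph obtained by removing the interior of a bounded edge. -/
def deleteEdge (E : G.B) : WeightedGraph where
  V := G.V
  B := {E' : G.B // E' ≠ E}
  U := G.U
  finV := G.finV
  finB := inferInstance
  finU := G.finU
  src E' := G.src E'.1
  tgt E' := G.tgt E'.1
  base := G.base
  weightB E' := G.weightB E'.1
  weightU := G.weightU
  weightB_pos E' := G.weightB_pos E'.1
  weightU_pos := G.weightU_pos

/-- The bounded edge `E` is part of a loop: removing its interior lowers the first Betti number. -/
def IsPartOfLoop (E : G.B) : Prop := (G.deleteEdge E).betti < G.betti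

/-- The set of edges of the loop part of the graph. -/
abbrev LoopEdge : Type := {E : G.B // G.IsPartOfLoop E}

end WeightedGraph

/-- A weighted graph with a rational position for each vertex and an integral direction for each
edge (for a bounded edge, the direction is the one from `src E` to `tgt E`). -/
structure DirectedGraphMap (n : ℕ) extends WeightedGraph where
  pos : V → (Fin n → ℚ)
  dirB : B → (Fin n → ℤ)
  dirU : U → (Fin n → ℤ)

/-- The direction of the edge of a flag, emanating from the vertex of the flag. -/
def DirectedGraphMap.flagDir {n : ℕ} (G : DirectedGraphMap n) : G.Flag → (Fin n → ℤ)
  | Sum.inl (E, false) => G.dirB E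
  | Sum.inl (E, true) => - G.dirB E
  | Sum.inr E => G.dirU E

open Classical in
/-- A parametrized tropical curve `h : Γ → ℝ^n` all of whose edges are mapped injectively: the
graph `Γ` is connected, a bounded edge is mapped affinely onto the segment between the positions of
its ends, an unbounded edge is mapped onto a half-line, the directions are the primitive integral
vectors along the edges, and the balancing condition holds at each vertex. -/
structure TropicalCurve (n : ℕ) extends DirectedGraphMap n where
  connected : toWeightedGraph.IsConnected
  dirB_primitive : ∀ E, IsPrimitive (dirB E)
  dirU_primitive : ∀ E, IsPrimitive (dirU E)
  edge : ∀ E, ∃ l : ℚ, 0 < l ∧ ∀ i, pos (tgt E) i = pos (src E) i + l * (dirB E i : ℚ)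
  balanced : ∀ v : V, ∑ f : toWeightedGraph.FlagAt v,
    toWeightedGraph.flagWeight f.1 • toDirectedGraphMap.flagDir f.1 = 0

namespace TropicalCurve

variable {n : ℕ} (T : TropicalCurve n)

/-- The position of a vertex as a real vector. -/
def posR (v : T.V) : Fin n → ℝ := fun i => (T.pos v i : ℝ)

/-- The map `h` on the points of `Γ`; a point of `Γ` is a vertex, an interior point of a bounded
edge (parametrized by the open unit interval), or an interior point of an unbounded edge
(parametrized by the positive reals). -/
def realization :
    T.V ⊕ (T.B × Set.Ioo (0 : ℝ) 1) ⊕ (T.U × Set.Ioi (0 : ℝ)) → (Fin n → ℝ)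
  | Sum.inl v => T.posR v
  | Sum.inr (Sum.inl (E, t)) =>
      (1 - (t : ℝ)) • T.posR (T.src E) + (t : ℝ) • T.posR (T.tgt E)
  | Sum.inr (Sum.inr (E, t)) => T.posR (T.base E) + (t : ℝ) • realVec (T.dirU E)

/-- The tropical curve is embedded. (The map `h` is continuous and proper, so that it is an
embedding if and only if it is injective.) -/
def IsEmbedded : Prop := Function.Injective T.realization

open Classical in
/-- The abundancy map
`ℝ^{L^{[1]}} → Hom(H_1(Γ), N_ℝ)`, `(l_E) ↦ (∑ a_E [E] ↦ ∑ l_E a_E u_E)`,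
where the sums are over the edges of the loop part (every cycle is supported there). -/
def abundancyMap : (T.LoopEdge → ℝ) → (T.H1 →ₗ[ℤ] (Fin n → ℝ)) := fun l =>
  ∑ E : T.LoopEdge, ((LinearMap.proj E.1 : (T.B → ℤ) →ₗ[ℤ] ℤ).comp T.H1.subtype).smulRight
    (l E • realVec (T.dirB E.1))

/-- Non-superabundancy: the abundancy map is surjective. -/
def IsNonSuperabundant : Prop := Function.Surjective T.abundancyMap

end TropicalCurve

/-! ## The complex projective line -/

/-- The Riemann sphere. Its automorphism group is `GL(2, ℂ)` (modulo scalars), acting by Möbius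
transformations; Mathlib's action is used. -/
abbrev P1 : Type := OnePoint ℂ

/-- A holomorphic coordinate of the Riemann sphere centred at `p`. -/
def P1.chart (p : P1) (z : ℂ) : P1 :=
  p.elim (if z = 0 then OnePoint.infty else ((z⁻¹ : ℂ) : P1)) (fun a => ((a + z : ℂ) : P1))

/-! ## Toric varieties and holomorphic maps to them -/

/-- The set of complex points of the toric variety of a fan `𝓕` in `ℝ^ι` (with the lattice `ℤ^ι`).
The toric variety is the disjoint union of the torus orbits `O_τ = Hom(τ^⊥ ∩ M, ℂ^*)`, for
`τ ∈ 𝓕`. A point of `O_τ` is recorded by the cone `τ` and by the extension by zero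
`ev : M → ℂ` of the homomorphism `τ^⊥ ∩ M → ℂ^*`. If `τ` is a face of `σ ∈ 𝓕`, so that `O_τ` is
contained in the affine chart `U_σ = Hom(σ^∨ ∩ M, ℂ)`, then `ev m` is the value of the regular
function `χ^m` at the point, for each `m ∈ σ^∨ ∩ M`. -/
@[ext]
structure ToricVariety {ι : Type} [Fintype ι] (𝓕 : Set (Set (ι → ℝ))) where
  cone : Set (ι → ℝ)
  cone_mem : cone ∈ 𝓕
  ev : (ι → ℤ) → ℂ
  ev_ne_zero_iff : ∀ m, ev m ≠ 0 ↔ ∀ x ∈ cone, pairing m x = 0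
  ev_add : ∀ m m', (∀ x ∈ cone, pairing m x = 0) → (∀ x ∈ cone, pairing m' x = 0) →
    ev (m + m') = ev m * ev m'

section ToricMaps

variable {ι : Type} [Fintype ι] {𝓕 : Set (Set (ι → ℝ))}

/-- Holomorphic maps from the Riemann sphere to a toric variety: near each point `p`, the map has
values in an affine chart `U_σ` (the union of the orbits of the faces of `σ`), and the pullbacks of
the regular functions `χ^m`, `m ∈ σ^∨ ∩ M`, on this chart are holomorphic at `p`. -/
def IsHolomorphic (f : P1 → ToricVariety 𝓕) : Prop :=
  ∀ p : P1, ∃ σ ∈ 𝓕, (∀ᶠ z in 𝓝 (0 : ℂ), (f (p.chart z)).cone ⊆ σ) ∧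
    ∀ m : ι → ℤ, (∀ x ∈ σ, 0 ≤ pairing m x) →
      AnalyticAt ℂ (fun z : ℂ => (f (p.chart z)).ev m) 0

/-- A torically transverse map from the Riemann sphere: it is holomorphic, the preimage of the big
torus (the orbit of the cone `0`) is dense, and the image is disjoint from the toric strata of
codimension greater than `1`. -/
def IsToricallyTransverse (f : P1 → ToricVariety 𝓕) : Prop :=
  IsHolomorphic f ∧ Dense {p : P1 | (f p).cone = {0}} ∧
    ∀ p : P1, Module.finrank ℝ (Submodule.span ℝ (f p).cone) ≤ 1

/-- At the point `p`, the map `f` meets the toric divisor of the ray spanned by the primitive vector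
`u` (and no other toric divisor), with intersection multiplicity `w`. A local equation of the divisor
at a point of its open orbit is `χ^m`, for any `m` with `⟨m, u⟩ = 1`. -/
def MeetsDivisor (f : P1 → ToricVariety 𝓕) (p : P1) (u : ι → ℤ) (w : ℕ) : Prop :=
  IsPrimitive u ∧ (f p).cone = rayCone u ∧
    ∀ m : ι → ℤ, (∑ i, m i * u i) = 1 →
      analyticOrderAt (fun z : ℂ => (f (p.chart z)).ev m) 0 = (w : ℕ∞)

/-- Rational curves of the type of a tropical curve with a single vertex and with edges `e : A`
of directions `u e` and weights `w e`, with marked points `p e`: a non-constant torically transverse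
map which meets, for each edge `e`, the toric divisor of the ray of `u e` at the point `p e` with
multiplicity `w e`, the points `p e` being distinct, and which does not meet the toric
divisors anywhere else. -/
structure IsOfVertexType {A : Type} (f : P1 → ToricVariety 𝓕) (u : A → (ι → ℤ)) (w : A → ℕ)
    (p : A → P1) : Prop where
  nonconstant : ∃ q q', f q ≠ f q'
  transverse : IsToricallyTransverse f
  injective : Function.Injective p
  meets : ∀ e, MeetsDivisor f (p e) (u e) (w e)
  only : ∀ q, q ∉ Set.range p → (f q).cone = {0}

end ToricMaps

/-! ## Polyhedral decompositions and toric degenerations -/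

/-- A rational polyhedron: a finite intersection of rational closed half-spaces. -/
def IsRationalPolyhedron {n : ℕ} (Ξ : Set (Fin n → ℝ)) : Prop :=
  ∃ s : Finset ((Fin n → ℤ) × ℤ), Ξ = {x | ∀ c ∈ s, (c.2 : ℝ) ≤ pairing c.1 x}

/-- An integral polyhedral decomposition of `ℝ^n`: a finite set of non-empty, strongly convex
rational polyhedra (the cells) covering `ℝ^n`, closed under taking non-empty faces, such that two
cells are disjoint or meet in a common face, and such that all the vertices are lattice points. -/
structure PolyhedralDecomposition (n : ℕ) where
  cells : Set (Set (Fin n → ℝ))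
  finite : cells.Finite
  nonempty : ∀ Ξ ∈ cells, Ξ.Nonempty
  polyhedron : ∀ Ξ ∈ cells, IsRationalPolyhedron Ξ
  no_line : ∀ Ξ ∈ cells, ∀ x d : Fin n → ℝ, (∀ t : ℝ, x + t • d ∈ Ξ) → d = 0
  cover : ⋃₀ cells = Set.univ
  face_mem : ∀ Ξ ∈ cells, ∀ F : Set (Fin n → ℝ), F.Nonempty → IsExposed ℝ Ξ F → F ∈ cells
  inter_face : ∀ Ξ ∈ cells, ∀ Ξ' ∈ cells, IsExposed ℝ Ξ (Ξ ∩ Ξ')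
  integral : ∀ x : Fin n → ℝ, {x} ∈ cells → ∃ v : Fin n → ℤ, x = realVec v

/-- The recession (asymptotic) cone of a polyhedron. -/
def recessionCone {n : ℕ} (Ξ : Set (Fin n → ℝ)) : Set (Fin n → ℝ) :=
  {y | ∀ x ∈ Ξ, ∀ t : ℝ, 0 ≤ t → x + t • y ∈ Ξ}

/-- The closure of the cone over `Ξ × {1}` in `ℝ^n × ℝ`. -/
def coneOver {n : ℕ} (Ξ : Set (Fin n → ℝ)) : Set (Fin n ⊕ Unit → ℝ) :=
  {z | (0 < z (Sum.inr ()) ∧ (z (Sum.inr ()))⁻¹ • (z ∘ Sum.inl) ∈ Ξ) ∨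
    (z (Sum.inr ()) = 0 ∧ z ∘ Sum.inl ∈ recessionCone Ξ)}

/-- The asymptotic cone of `Ξ`, at height `0` in `ℝ^n × ℝ`. -/
def coneAtInfinity {n : ℕ} (Ξ : Set (Fin n → ℝ)) : Set (Fin n ⊕ Unit → ℝ) :=
  {z | z (Sum.inr ()) = 0 ∧ z ∘ Sum.inl ∈ recessionCone Ξ}

/-- Extending an integral vector by a last coordinate. -/
def extend {n : ℕ} (m : Fin n → ℤ) (k : ℤ) : Fin n ⊕ Unit → ℤ := Sum.elim m (fun _ => k)

namespace PolyhedralDecomposition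

variable {n : ℕ} (P : PolyhedralDecomposition n)

/-- The vertices of the decomposition. -/
abbrev Vertex : Type := {v : Fin n → ℤ // {realVec v} ∈ P.cells}

/-- The fan in `ℝ^n × ℝ` of the toric degeneration. -/
def degenerationFan : Set (Set (Fin n ⊕ Unit → ℝ)) :=
  {κ | ∃ Ξ ∈ P.cells, κ = coneOver Ξ ∨ κ = coneAtInfinity Ξ}

/-- The total space `𝔛` of the toric degeneration. -/
abbrev TotalSpace : Type := ToricVariety P.degenerationFan

/-- The projection `𝔛 → ℂ`, given by the monomial of the last coordinate. -/
def projection (x : P.TotalSpace) : ℂ := x.ev (extend 0 1)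

/-- The central fiber `X_0`. -/
def centralFiber : Set P.TotalSpace := {x | P.projection x = 0}

/-- The component `X_v` of the central fiber, for a vertex `v`: the closure of the orbit of the ray
spanned by `(v, 1)`, that is the union of the orbits of the cones which contain `(v, 1)`. -/
def component (v : P.Vertex) : Set P.TotalSpace :=
  {x | realVec (extend v.1 1) ∈ x.cone}

/-- The projection `ℝ^n × ℝ → ℝ^n` along `(v, 1)`. -/
def projAlong (v : P.Vertex) (z : Fin n ⊕ Unit → ℝ) : Fin n → ℝ :=
  z ∘ Sum.inl - z (Sum.inr ()) • realVec v.1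

/-- The fan of the toric variety `X_v`: the projections along `(v, 1)` of the cones which contain
`(v, 1)`, or, in other words, the tangent cones at `v` of the cells which contain `v`. -/
def starFan (v : P.Vertex) : Set (Set (Fin n → ℝ)) :=
  {σ | ∃ κ ∈ P.degenerationFan, realVec (extend v.1 1) ∈ κ ∧ σ = P.projAlong v '' κ}

theorem pairing_extend (v : P.Vertex) (m : Fin n → ℤ) (z : Fin n ⊕ Unit → ℝ) :
    pairing (extend m (- ∑ i, m i * v.1 i)) z = pairing m (P.projAlong v z) := by
  have h : ∀ i, (m i : ℝ) * (z (Sum.inl i) - z (Sum.inr ()) * (v.1 i : ℝ)) =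
      (m i : ℝ) * z (Sum.inl i) - ((m i : ℝ) * (v.1 i : ℝ)) * z (Sum.inr ()) := fun i => by ring
  have h' : pairing m (P.projAlong v z) = ∑ i, (m i : ℝ) * z (Sum.inl i) -
      (∑ i, (m i : ℝ) * (v.1 i : ℝ)) * z (Sum.inr ()) := by
    rw [Finset.sum_mul, ← Finset.sum_sub_distrib]
    exact Finset.sum_congr rfl fun i _ => h i
  rw [h']
  simp [pairing, extend, sub_eq_add_neg]

theorem component_subset_centralFiber (v : P.Vertex) : P.component v ⊆ P.centralFiber := by
  intro x hx
  by_contra h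
  have h1 := (x.ev_ne_zero_iff _).1 h _ hx
  simp [pairing, extend, realVec] at h1

/-- The identification of the component `X_v` with the toric variety of the fan `starFan v`.
The character lattice of the orbits of `X_v` is identified by `m ↦ (m, - ⟨m, v⟩)` with the
orthogonal complement of `(v, 1)`. -/
def toToric (v : P.Vertex) (x : P.component v) : ToricVariety (P.starFan v) where
  cone := P.projAlong v '' x.1.cone
  cone_mem := ⟨x.1.cone, x.1.cone_mem, x.2, rfl⟩
  ev m := x.1.ev (extend m (- ∑ i, m i * v.1 i))
  ev_ne_zero_iff m := by
    rw [x.1.ev_ne_zero_iff]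
    simp only [pairing_extend, Set.forall_mem_image]
  ev_add m m' hm hm' := by
    rw [Set.forall_mem_image] at hm hm'
    rw [← x.1.ev_add _ _ (fun z hz => by rw [pairing_extend]; exact hm hz)
      (fun z hz => by rw [pairing_extend]; exact hm' hz)]
    congr 1
    funext i
    cases i with
    | inl i => simp [extend]
    | inr i => simp [extend, add_mul, Finset.sum_add_distrib]; ring

/-- The locus where the central fiber is singular because at least two of its components meet. (The
remaining singular points are toric singularities of the components, which lie in strata of
codimension greater than `1` of the components and are never met by torically transverse
curves.) -/
def singularLocus : Set P.TotalSpace :=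
  {x | ∃ v v' : P.Vertex, v ≠ v' ∧ x ∈ P.component v ∧ x ∈ P.component v'}

end PolyhedralDecomposition

/-- The decomposition `P` defines a toric degeneration respecting the tropical curve `T`: for some
positive integer `scale` (one passes from rational to integral vertices by a rescaling), the map
`scale • h` is cellular. This means that its image is in the `1`-skeleton of `P` and
that the vertices of `P` on the image are exactly the images of the vertices of `Γ`, where `Γ` may
have `2`-valent vertices. -/
structure Respects {n : ℕ} (P : PolyhedralDecomposition n) (T : TropicalCurve n) where
  scale : ℕ
  scale_pos : 0 < scale
  vertex : T.V → P.Vertex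
  vertex_eq : ∀ v, realVec (vertex v).1 = (scale : ℝ) • T.posR v
  edgeB_mem : ∀ E, segment ℝ (realVec (vertex (T.src E)).1) (realVec (vertex (T.tgt E)).1) ∈ P.cells
  edgeU_mem : ∀ E, {x | ∃ t : ℝ, 0 ≤ t ∧
    x = realVec (vertex (T.base E)).1 + t • realVec (T.dirU E)} ∈ P.cells

/-! ## Pre-log curves -/

/-- A (complete, connected) prestable curve all of whose components have the Riemann sphere as
normalization: the nodal curve obtained from the disjoint union of finitely many
Riemann spheres `{i} × P1` by gluing, for each node `k`, the two points `branch k false` and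
`branch k true`. -/
structure PrestableCurve where
  comp : Type
  node : Type
  finComp : Finite comp
  finNode : Finite node
  branch : node → Bool → comp × P1
  branch_injective : Function.Injective (fun kb : node × Bool => branch kb.1 kb.2)
  nonempty : Nonempty comp
  connected : ∀ i j : comp, Relation.EqvGen
    (fun a b => ∃ k, (branch k false).1 = a ∧ (branch k true).1 = b) i j

/-- A pre-log curve `φ_0 : C_0 → X_0` on the central fiber (with components of `C_0` as above). It is
given by its restrictions `map i` to the normalizations of the components; as the restrictions of
`φ_0` over each `X_v` are torically transverse, each component is mapped to exactly one `X_v`. -/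
structure PreLogCurve {n : ℕ} (P : PolyhedralDecomposition n) extends PrestableCurve where
  vertex : comp → P.Vertex
  map : (i : comp) → P1 → P.component (vertex i)
  /-- The maps are compatible with the gluing at the nodes. -/
  glue : ∀ k, (map (branch k false).1 (branch k false).2).1 =
    (map (branch k true).1 (branch k true).2).1
  /-- Stability: a contracted component has at least three special points. -/
  stable : ∀ i, (∃ x, ∀ q, map i q = x) →
    3 ≤ Nat.card {kb : node × Bool // (branch kb.1 kb.2).1 = i}
  /-- Torical transversality over each component of the central fiber. -/
  transverse : ∀ i, IsToricallyTransverse (fun q => P.toToric (vertex i) (map i q))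
  /-- The points mapped to the singular locus are nodes. -/
  node_of_singular : ∀ i q, (map i q).1 ∈ P.singularLocus → ∃ k b, branch k b = (i, q)
  /-- At the nodes mapped to the singular locus, the two branches are mapped to different components
  and have the same intersection index with the toric divisor. -/
  node_condition : ∀ k, (map (branch k false).1 (branch k false).2).1 ∈ P.singularLocus →
    vertex (branch k false).1 ≠ vertex (branch k true).1 ∧
    ∃ (w : ℕ) (u u' : Fin n → ℤ),
      MeetsDivisor (fun q => P.toToric (vertex (branch k false).1) (map (branch k false).1 q))
        (branch k false).2 u w ∧
      MeetsDivisor (fun q => P.toToric (vertex (branch k true).1) (map (branch k true).1 q))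
        (branch k true).2 u' w

/-- A curve in the component of the central fiber which belongs to the vertex `v` of the tropical
curve, with one marked point for each edge emanating from `v`, is of type `v`. -/
def IsOfTypeAt {n : ℕ} {P : PolyhedralDecomposition n} {T : TropicalCurve n} (R : Respects P T)
    (v : T.V) (f : P1 → P.component (R.vertex v)) (mark : T.FlagAt v → P1) : Prop :=
  IsOfVertexType (fun q => P.toToric (R.vertex v) (f q))
    (fun e => T.flagDir e.1) (fun e => T.flagWeight e.1) mark

/-- The pre-log curve `φ` is of type `(Γ, h)`, for an embedded tropical curve: its components
correspond to the vertices of `Γ`, the component of `v` is mapped to the component of the central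
fiber which belongs to `v` and is a curve of type `v`, and `Γ` is the dual intersection graph: the
nodes correspond to the bounded edges, and the node of `E` joins the marked points which belong to
the two flags of `E`. The marked points are part of the data. -/
structure PreLogCurve.OfType {n : ℕ} {P : PolyhedralDecomposition n} {T : TropicalCurve n}
    (R : Respects P T) (φ : PreLogCurve P) where
  comp : T.V ≃ φ.comp
  node : T.B ≃ φ.node
  mark : (v : T.V) → T.FlagAt v → P1
  map : (v : T.V) → P1 → P.component (R.vertex v)
  vertex_eq : ∀ v, φ.vertex (comp v) = R.vertex v
  /-- `map v` is the restriction of `φ` to the component of `v`. -/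
  map_eq : ∀ v q, (map v q).1 = (φ.map (comp v) q).1
  type : ∀ v, IsOfTypeAt R v (map v) (mark v)
  node_eq : ∀ E,
    s(φ.branch (node E) false, φ.branch (node E) true) =
      s((comp (T.src E), mark (T.src E) ⟨Sum.inl (E, false), rfl⟩),
        (comp (T.tgt E), mark (T.tgt E) ⟨Sum.inl (E, true), rfl⟩))

end TropicalPreLog

end

open TropicalPreLog

namespace TropicalPreLog

/-! Over each edge of `Γ` the two given curves meet the double locus of `X_0` in points of the same
torus orbit: both marked points lie in the orbit of the cone over the cell that is the image of the
edge. Hence it is enough to move the given curves by torus elements `exp a_V` such that, for every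
edge `E`, the two points come to coincide. The orbit of `E` is a torsor under the torus modulo the
one-parameter subgroup of `u_E`, so the condition on `(a_V)` is that its coboundary on `E` is a
prescribed vector `b_E` up to a multiple of `u_E`. The obstruction to solving this is the class of
`b` in `Hom(H_1(Γ), N_ℂ)`, and it vanishes for a suitable choice of the multiples as the abundancy
map is surjective. -/

/-! ### Homomorphisms to divisible groups -/

theorem exists_comp_eq_of_ker_le_of_baer {R M N Q : Type*} [Ring R] [AddCommGroup M]
    [AddCommGroup N] [AddCommGroup Q] [Module R M] [Module R N] [Module R Q]
    (hQ : Module.Baer R Q) {f : M →ₗ[R] N} {g : M →ₗ[R] Q}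
    (h : LinearMap.ker f ≤ LinearMap.ker g) : ∃ k : N →ₗ[R] Q, k ∘ₗ f = g := by
  obtain ⟨k, hk⟩ := hQ.extension_property ((LinearMap.ker f).liftQ f le_rfl)
    (LinearMap.ker_eq_bot.1 (Submodule.ker_liftQ_eq_bot' _ _ rfl)) ((LinearMap.ker f).liftQ g h)
  exact ⟨k, by rw [← (LinearMap.ker f).liftQ_mkQ f le_rfl, ← LinearMap.comp_assoc, hk,
    Submodule.liftQ_mkQ]⟩

theorem units_zpow_surjective {k : Type*} [Field k] [IsAlgClosed k] {n : ℤ} (hn : n ≠ 0) :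
    Function.Surjective fun x : kˣ => x ^ n := by
  have pow_surjective : Function.Surjective fun x : kˣ => x ^ n.natAbs := fun y => by
    obtain ⟨z, hz⟩ := IsAlgClosed.exists_pow_nat_eq (y : k) (Int.natAbs_pos.2 hn)
    have hz0 : z ≠ 0 := by
      rintro rfl
      exact y.ne_zero (by rw [← hz, zero_pow (Int.natAbs_ne_zero.2 hn)])
    exact ⟨Units.mk0 z hz0, Units.ext hz⟩
  intro y
  rcases n.natAbs_eq with h | h
  · obtain ⟨x, hx⟩ := pow_surjective y
    exact ⟨x, by rw [← hx]; dsimp only; rw [h, zpow_natCast, Int.natAbs_natCast]⟩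
  · obtain ⟨x, hx⟩ := pow_surjective y⁻¹
    exact ⟨x, inv_injective (by
      rw [← hx]; dsimp only; rw [← zpow_neg, ← zpow_natCast]; congr 1; lia)⟩

theorem exists_addChar_extending {A k : Type*} [AddCommGroup A] [Field k] [IsAlgClosed k]
    (L : AddSubgroup A) (χ : AddChar L k) : ∃ ψ : AddChar A k, ∀ m : L, ψ m = χ m := by
  let _ : DivisibleBy (Additive kˣ) ℤ := divisibleByOfSMulRightSurj _ _ units_zpow_surjective
  obtain ⟨ψ, hψ⟩ := (Module.Baer.of_divisible (Additive kˣ)).extension_property_addMonoidHom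
    L.subtype L.subtype_injective
    (AddChar.toAddMonoidHomEquiv (AddChar.toMonoidHomEquiv.symm χ.toMonoidHom.toHomUnits))
  refine ⟨(Units.coeHom k).compAddChar (AddChar.toAddMonoidHomEquiv.symm ψ), fun m => ?_⟩
  exact congrArg (fun y : Additive kˣ => (y.toMul : k)) (DFunLike.congr_fun hψ m)

/-! ### Cochains on a tropical curve -/

namespace WeightedGraph

variable (G : WeightedGraph)

open Classical in
theorem boundary_single (E : G.B) :
    G.boundary (Pi.single E 1) = Pi.single (G.tgt E) 1 - Pi.single (G.src E) 1 := by
  rw [boundary, LinearMap.sum_apply, Finset.sum_eq_single E]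
  · simp only [LinearMap.smulRight_apply, LinearMap.proj_apply, Pi.single_eq_same, one_smul]
  · intro E' _ hE'
    simp only [LinearMap.smulRight_apply, LinearMap.proj_apply, Pi.single_eq_of_ne hE', zero_smul]
  · exact fun h => absurd (Finset.mem_univ E) h

theorem exists_potential {A : Type*} [AddCommGroup A] [DivisibleBy A ℤ] (b : G.B → A)
    (hb : ∀ c ∈ G.H1, ∑ E, c E • b E = 0) :
    ∃ p : G.V → A, ∀ E, p (G.tgt E) - p (G.src E) = b E := by
  classical
  have hker : LinearMap.ker G.boundary ≤ LinearMap.ker (Fintype.linearCombination ℤ b) := hb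
  obtain ⟨k, hk⟩ := exists_comp_eq_of_ker_le_of_baer (Module.Baer.of_divisible A) hker
  refine ⟨fun v => k (Pi.single v 1), fun E => ?_⟩
  calc k (Pi.single (G.tgt E) 1) - k (Pi.single (G.src E) 1)
      = k (G.boundary (Pi.single E 1)) := by
        rw [← map_sub]
        convert (congrArg k (G.boundary_single E)).symm
    _ = Fintype.linearCombination ℤ b (Pi.single E 1) := LinearMap.congr_fun hk _
    _ = b E := by rw [Fintype.linearCombination_apply_single, one_smul]

end WeightedGraph

namespace TropicalCurve

variable {n : ℕ} {T : TropicalCurve n}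

open Classical in
theorem abundancyMap_apply (l : T.LoopEdge → ℝ) (c : T.H1) :
    T.abundancyMap l c =
      ∑ E, c.1 E • Function.extend Subtype.val l 0 E • realVec (T.dirB E) := by
  rw [abundancyMap, LinearMap.sum_apply]
  refine Fintype.sum_of_injective Subtype.val Subtype.val_injective _ _ (fun E hE => ?_)
    fun E => ?_
  · rw [Function.extend_apply' _ _ _ hE, Pi.zero_apply, zero_smul, smul_zero]
  · rw [Subtype.val_injective.extend_apply]
    rfl

namespace IsNonSuperabundant

theorem exists_sub_eq_add_smul_realVec (hT : T.IsNonSuperabundant) (b : T.B → Fin n → ℝ) :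
    ∃ (a : T.V → Fin n → ℝ) (l : T.B → ℝ),
      ∀ E, a (T.tgt E) - a (T.src E) = b E + l E • realVec (T.dirB E) := by
  obtain ⟨l, hl⟩ := hT (-(Fintype.linearCombination ℤ b).comp T.H1.subtype)
  let l' : T.B → ℝ := Function.extend Subtype.val l 0
  obtain ⟨a, ha⟩ := T.exists_potential (fun E => b E + l' E • realVec (T.dirB E)) fun c hc => by
    have hc' : -∑ E, c E • b E = ∑ E, c E • l' E • realVec (T.dirB E) := by
      rw [← abundancyMap_apply l ⟨c, hc⟩, hl]
      rfl
    simp only [smul_add, Finset.sum_add_distrib, ← hc', add_neg_cancel]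
  exact ⟨a, l', ha⟩

theorem exists_sub_eq_add_smul (hT : T.IsNonSuperabundant) (b : T.B → Fin n → ℂ) :
    ∃ (a : T.V → Fin n → ℂ) (l : T.B → ℂ),
      ∀ E, a (T.tgt E) - a (T.src E) = b E + l E • (Int.cast ∘ T.dirB E) := by
  obtain ⟨a, l, h⟩ := hT.exists_sub_eq_add_smul_realVec fun E i => (b E i).re
  obtain ⟨a', l', h'⟩ := hT.exists_sub_eq_add_smul_realVec fun E i => (b E i).im
  refine ⟨fun v i => ⟨a v i, a' v i⟩, fun E => ⟨l E, l' E⟩, fun E => funext fun i => ?_⟩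
  have hre := congrFun (h E) i
  have him := congrFun (h' E) i
  refine Complex.ext ?_ ?_
  · simpa [realVec] using hre
  · simpa [realVec] using him

end IsNonSuperabundant

end TropicalCurve

/-! ### The action of the torus on a toric variety -/

/-- The complex points `Hom(ℤ^ι, ℂ^*)` of the torus with character lattice `ℤ^ι`; the values of an
additive character of a group are automatically units. -/
abbrev Torus (ι : Type) : Type := AddChar (ι → ℤ) ℂ

namespace Torus

variable {ι : Type} [Fintype ι]

/-- The exponential map `N_ℂ → N ⊗ ℂ^*` of the torus. -/
noncomputable def exp (a : ι → ℂ) : Torus ι where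
  toFun m := Complex.exp (∑ i, (m i : ℂ) * a i)
  map_zero_eq_one' := by simp
  map_add_eq_mul' m m' := by simp [← Complex.exp_add, add_mul, Finset.sum_add_distrib]

theorem exp_apply (a : ι → ℂ) (m : ι → ℤ) : exp a m = Complex.exp (∑ i, (m i : ℂ) * a i) := rfl

theorem exp_add (a b : ι → ℂ) : exp (a + b) = exp a * exp b := by
  ext m
  simp only [AddChar.mul_apply, exp_apply, Pi.add_apply, mul_add, Finset.sum_add_distrib,
    Complex.exp_add]

theorem exp_surjective : Function.Surjective (exp : (ι → ℂ) → Torus ι) := by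
  classical
  intro t
  refine ⟨fun i => Complex.log (t (Pi.single i 1)), AddChar.ext _ _ fun m => ?_⟩
  have ht : ∀ i, t (Pi.single i 1) ≠ 0 := fun i => (t.val_isUnit _).ne_zero
  calc exp (fun i => Complex.log (t (Pi.single i 1))) m
      = ∏ i, t (Pi.single i 1) ^ m i := by
        simp only [exp_apply, Complex.exp_sum, Complex.exp_int_mul, Complex.exp_log (ht _)]
    _ = ∏ i, t (m i • Pi.single i 1) := by simp only [AddChar.map_zsmul_eq_zpow]
    _ = t (∑ i, m i • Pi.single i 1) :=
        (map_prod t.toMonoidHom (fun i => Multiplicative.ofAdd (m i • Pi.single i 1)) _).symm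
    _ = t m := by rw [← pi_eq_sum_univ']

end Torus

section

variable {ι : Type} [Fintype ι]

theorem isLinearMap_pairing (m : ι → ℤ) : IsLinearMap ℝ (pairing m) where
  map_add := dotProduct_add (realVec m)
  map_smul c x := dotProduct_smul c (realVec m) x

theorem pairing_realVec (m u : ι → ℤ) : pairing m (realVec u) = (∑ i, m i * u i : ℤ) := by
  simp [pairing, realVec]

/-- The sublattice `τ^⊥ ∩ M` of the characters that are defined on the torus orbit of `τ`. -/
def orthogonalLattice (τ : Set (ι → ℝ)) : AddSubgroup (ι → ℤ) where
  carrier := {m | ∀ x ∈ τ, pairing m x = 0}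
  zero_mem' x _ := by simp [pairing]
  add_mem' {m m'} hm hm' x hx := by
    have h : pairing (m + m') x = pairing m x + pairing m' x := by
      simp [pairing, add_mul, Finset.sum_add_distrib]
    rw [h, hm x hx, hm' x hx, add_zero]
  neg_mem' {m} hm x hx := by
    have h : pairing (-m) x = -pairing m x := by simp [pairing]
    rw [h, hm x hx, neg_zero]

theorem sum_mul_eq_zero_of_mem_span {τ : Set (ι → ℝ)} {m u : ι → ℤ}
    (hm : m ∈ orthogonalLattice τ) (hu : realVec u ∈ Submodule.span ℝ τ) :
    ∑ i, m i * u i = 0 := by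
  have hspan : Submodule.span ℝ τ ≤ LinearMap.ker (isLinearMap_pairing m).mk' :=
    Submodule.span_le.2 hm
  exact_mod_cast (pairing_realVec m u).symm.trans (hspan hu)

end

namespace ToricVariety

variable {ι : Type} [Fintype ι] {𝓕 : Set (Set (ι → ℝ))} {x y : ToricVariety 𝓕}

theorem ext_of_eqOn (hcone : x.cone = y.cone)
    (hev : Set.EqOn x.ev y.ev (orthogonalLattice x.cone)) : x = y := by
  refine ToricVariety.ext hcone (funext fun m => ?_)
  by_cases hm : m ∈ orthogonalLattice x.cone
  · exact hev hm
  · have hx : x.ev m = 0 := not_not.1 (mt (x.ev_ne_zero_iff m).1 hm)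
    have hy : y.ev m = 0 := not_not.1 (mt (y.ev_ne_zero_iff m).1 (hcone ▸ hm))
    rw [hx, hy]

/-- The homomorphism `τ^⊥ ∩ M → ℂ^*` which is the point `x` of the orbit of `τ`. -/
def orbitChar (x : ToricVariety 𝓕) : AddChar (orthogonalLattice x.cone) ℂ where
  toFun m := x.ev m
  map_zero_eq_one' := by
    have hzero : (0 : ι → ℤ) ∈ orthogonalLattice x.cone := zero_mem _
    refine mul_left_cancel₀ ((x.ev_ne_zero_iff 0).2 hzero) ?_
    rw [mul_one]
    simpa using (x.ev_add 0 0 hzero hzero).symm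
  map_add_eq_mul' m m' := x.ev_add m m' m.2 m'.2

instance : MulAction (Torus ι) (ToricVariety 𝓕) where
  smul t x :=
    { cone := x.cone
      cone_mem := x.cone_mem
      ev m := t m * x.ev m
      ev_ne_zero_iff m := by
        rw [← x.ev_ne_zero_iff, mul_ne_zero_iff_left (t.val_isUnit m).ne_zero]
      ev_add m m' hm hm' := by rw [t.map_add_eq_mul, x.ev_add m m' hm hm', mul_mul_mul_comm] }
  one_smul x := ToricVariety.ext rfl (funext fun m => one_mul (x.ev m))
  mul_smul t t' x := ToricVariety.ext rfl (funext fun m => mul_assoc (t m) (t' m) (x.ev m))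

theorem smul_ev (t : Torus ι) (x : ToricVariety 𝓕) (m : ι → ℤ) : (t • x).ev m = t m * x.ev m :=
  rfl

theorem exists_smul_eq_of_cone_eq (h : x.cone = y.cone) : ∃ t : Torus ι, t • y = x := by
  obtain ⟨s, hs⟩ := exists_addChar_extending _ x.orbitChar
  obtain ⟨t, ht⟩ := exists_addChar_extending _ y.orbitChar
  refine ⟨s / t, ext_of_eqOn h.symm fun m hm => ?_⟩
  have hsx : s m = x.ev m := hs ⟨m, h ▸ hm⟩
  have hty : t m = y.ev m := ht ⟨m, hm⟩
  rw [smul_ev, AddChar.div_apply', hsx, ← hty, div_mul_cancel₀ _ (t.val_isUnit m).ne_zero]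

theorem exp_smul_eq_self {u : ι → ℤ} (hu : realVec u ∈ Submodule.span ℝ x.cone) (l : ℂ) :
    Torus.exp (l • (Int.cast ∘ u)) • x = x := by
  refine ext_of_eqOn rfl fun m hm => ?_
  have hmu : ∑ i, (m i : ℂ) * (u i : ℂ) = 0 := by
    exact_mod_cast sum_mul_eq_zero_of_mem_span hm hu
  have hexp : Torus.exp (l • (Int.cast ∘ u)) m = 1 := by
    simp [Torus.exp_apply, mul_left_comm, ← Finset.mul_sum, hmu]
  rw [smul_ev, hexp, one_mul]

end ToricVariety

/-! ### Torus translates of rational curves -/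

theorem analyticOrderAt_const_smul {𝕜 E : Type*} [NontriviallyNormedField 𝕜]
    [NormedAddCommGroup E] [NormedSpace 𝕜 E] {c : 𝕜} (hc : c ≠ 0) (f : 𝕜 → E) (z : 𝕜) :
    analyticOrderAt (fun x => c • f x) z = analyticOrderAt f z := by
  by_cases hf : AnalyticAt 𝕜 f z
  · have h := analyticOrderAt_smul (analyticAt_const (v := c)) hf
    rwa [analyticAt_const.analyticOrderAt_eq_zero.2 hc, zero_add] at h
  · have hcf : ¬ AnalyticAt 𝕜 (fun x => c • f x) z := fun h => hf <| by
      simpa only [Pi.smul_def, inv_smul_smul₀ hc] using h.const_smul (c := c⁻¹)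
    rw [analyticOrderAt_of_not_analyticAt hf, analyticOrderAt_of_not_analyticAt hcf]

section

variable {ι : Type} [Fintype ι] {𝓕 : Set (Set (ι → ℝ))} {f : P1 → ToricVariety 𝓕}

theorem IsHolomorphic.smul (hf : IsHolomorphic f) (t : Torus ι) :
    IsHolomorphic fun q => t • f q := fun p => by
  obtain ⟨σ, hσ, hcone, han⟩ := hf p
  exact ⟨σ, hσ, hcone, fun m hm => analyticAt_const.mul (han m hm)⟩

theorem IsToricallyTransverse.smul (hf : IsToricallyTransverse f) (t : Torus ι) :
    IsToricallyTransverse fun q => t • f q :=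
  ⟨hf.1.smul t, hf.2⟩

theorem MeetsDivisor.smul {p : P1} {u : ι → ℤ} {w : ℕ} (hf : MeetsDivisor f p u w)
    (t : Torus ι) : MeetsDivisor (fun q => t • f q) p u w :=
  ⟨hf.1, hf.2.1, fun m hm =>
    (analyticOrderAt_const_smul (t.val_isUnit m).ne_zero _ _).trans (hf.2.2 m hm)⟩

theorem IsOfVertexType.smul {A : Type} {u : A → (ι → ℤ)} {w : A → ℕ} {p : A → P1}
    (hf : IsOfVertexType f u w p) (t : Torus ι) : IsOfVertexType (fun q => t • f q) u w p where
  nonconstant := by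
    obtain ⟨q, q', h⟩ := hf.nonconstant
    exact ⟨q, q', (MulAction.injective t).ne h⟩
  transverse := hf.transverse.smul t
  injective := hf.injective
  meets e := (hf.meets e).smul t
  only := hf.only

end

/-! ### Cells emanating from a vertex -/

section

variable {E : Type*} [AddCommGroup E] [Module ℝ E]

/-- The half-line from `v` in the direction `u`. -/
def halfLine (v u : E) : Set E := {x | ∃ t : ℝ, 0 ≤ t ∧ x = v + t • u}

/-- The set `Ξ` leaves its point `v` exactly in the direction `u`. For a convex set this means that
it is a non-degenerate segment or a half-line with end `v`. -/
structure Emanates (Ξ : Set E) (v u : E) : Prop where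
  base_mem : v ∈ Ξ
  subset : Ξ ⊆ halfLine v u
  exists_pos : ∃ s : ℝ, 0 < s ∧ v + s • u ∈ Ξ

theorem emanates_segment (v u : E) {l : ℝ} (hl : 0 < l) :
    Emanates (segment ℝ v (v + l • u)) v u where
  base_mem := left_mem_segment _ _ _
  subset := by
    rw [segment_eq_image']
    rintro _ ⟨θ, hθ, rfl⟩
    exact ⟨θ * l, mul_nonneg hθ.1 hl.le, by module⟩
  exists_pos := ⟨l, hl, right_mem_segment _ _ _⟩

theorem add_smul_mem_of_convex {Ξ : Set E} (hΞ : Convex ℝ Ξ) {v u : E} {s t : ℝ} (hv : v ∈ Ξ)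
    (hs : v + s • u ∈ Ξ) (ht : 0 ≤ t) (hts : t ≤ s) : v + t • u ∈ Ξ := by
  rcases ht.eq_or_lt with rfl | ht
  · rwa [zero_smul, add_zero]
  · have hs0 : 0 < s := ht.trans_le hts
    have hmem := hΞ.add_smul_mem hv hs ⟨(div_pos ht hs0).le, (div_le_one hs0).2 hts⟩
    rwa [smul_smul, div_mul_cancel₀ _ hs0.ne'] at hmem

theorem Emanates.inter {Ξ Ξ' : Set E} {v u : E} (hΞ : Convex ℝ Ξ) (hΞ' : Convex ℝ Ξ')
    (h : Emanates Ξ v u) (h' : Emanates Ξ' v u) : Emanates (Ξ ∩ Ξ') v u := by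
  obtain ⟨s, hs, hmem⟩ := h.exists_pos
  obtain ⟨s', hs', hmem'⟩ := h'.exists_pos
  have hmin : 0 < min s s' := lt_min hs hs'
  exact ⟨⟨h.base_mem, h'.base_mem⟩, Set.inter_subset_left.trans h.subset, min s s', hmin,
    add_smul_mem_of_convex hΞ h.base_mem hmem hmin.le (min_le_left _ _),
    add_smul_mem_of_convex hΞ' h'.base_mem hmem' hmin.le (min_le_right _ _)⟩

theorem Emanates.subset_of_isExtreme {Ξ F : Set E} {v u : E} (h : Emanates Ξ v u)
    (hF : Emanates F v u) (hconv : Convex ℝ F) (hext : IsExtreme ℝ Ξ F) : Ξ ⊆ F := by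
  obtain ⟨s, hs, hmem⟩ := hF.exists_pos
  intro y hy
  obtain ⟨t, ht, rfl⟩ := h.subset hy
  rcases le_or_gt t s with hts | hst
  · exact add_smul_mem_of_convex hconv hF.base_mem hmem ht hts
  · have ht0 : 0 < t := hs.trans hst
    refine hext.right_mem_of_mem_openSegment h.base_mem hy hmem ?_
    rw [openSegment_eq_image']
    refine ⟨s / t, ⟨div_pos hs ht0, (div_lt_one ht0).2 hst⟩, ?_⟩
    match_scalars
    · ring
    · field_simp

theorem extremePoints_halfLine_subset (v u : E) :
    (halfLine v u).extremePoints ℝ ⊆ {v} := by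
  rintro _ ⟨⟨t, ht, rfl⟩, hext⟩
  refine (hext (x₁ := v) ⟨0, le_rfl, by simp⟩ (x₂ := v + (2 * t) • u)
    ⟨2 * t, by positivity, rfl⟩ ⟨1 / 2, 1 / 2, by norm_num, by norm_num, by norm_num, ?_⟩).symm
  module

end

theorem IsRationalPolyhedron.convex {n : ℕ} {Ξ : Set (Fin n → ℝ)} (h : IsRationalPolyhedron Ξ) :
    Convex ℝ Ξ := by
  obtain ⟨s, rfl⟩ := h
  simp only [Set.ofPred_forall]
  exact convex_iInter₂ fun c _ => convex_halfSpace_ge (isLinearMap_pairing c.1) _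

theorem realVec_injective {ι : Type} : Function.Injective (realVec : (ι → ℤ) → ι → ℝ) :=
  fun _ _ h => funext fun i => Int.cast_injective (congrFun h i)

theorem IsPrimitive.realVec_ne_zero {ι : Type} {u : ι → ℤ} (hu : IsPrimitive u) :
    realVec u ≠ 0 := fun h => by
  have hu0 : u = 0 := realVec_injective (h.trans (funext fun _ => Int.cast_zero.symm))
  exact not_isUnit_zero (hu 0 0 (by rw [hu0, smul_zero]))

namespace PolyhedralDecomposition

variable {n : ℕ} {P : PolyhedralDecomposition n}

theorem cell_subset_of_emanates {Ξ Ξ' : Set (Fin n → ℝ)} (hΞ : Ξ ∈ P.cells) (hΞ' : Ξ' ∈ P.cells)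
    {v u : Fin n → ℝ} (h : Emanates Ξ v u) (h' : Emanates Ξ' v u) : Ξ ⊆ Ξ' := by
  have hconv := (P.polyhedron Ξ hΞ).convex
  have hconv' := (P.polyhedron Ξ' hΞ').convex
  have hface : IsExtreme ℝ Ξ (Ξ ∩ Ξ') := (P.inter_face Ξ hΞ Ξ' hΞ').isExtreme
  exact (h.subset_of_isExtreme (h.inter hconv hconv' h') (hconv.inter hconv') hface).trans
    Set.inter_subset_right

theorem cell_eq_of_emanates {Ξ Ξ' : Set (Fin n → ℝ)} (hΞ : Ξ ∈ P.cells) (hΞ' : Ξ' ∈ P.cells)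
    {v u : Fin n → ℝ} (h : Emanates Ξ v u) (h' : Emanates Ξ' v u) : Ξ = Ξ' :=
  (cell_subset_of_emanates hΞ hΞ' h h').antisymm (cell_subset_of_emanates hΞ' hΞ h' h)

theorem Vertex.mem_extremePoints (w : P.Vertex) {Ξ : Set (Fin n → ℝ)} (hΞ : Ξ ∈ P.cells)
    (hw : realVec w.1 ∈ Ξ) : realVec w.1 ∈ Ξ.extremePoints ℝ := by
  have hface := (P.inter_face Ξ hΞ _ w.2).isExtreme
  rwa [Set.inter_eq_right.2 (Set.singleton_subset_iff.2 hw), isExtreme_singleton] at hface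

/-! ### Torus orbits of the components of the central fiber -/

theorem realVec_extend_one_mem_coneOver {Ξ : Set (Fin n → ℝ)} {w : Fin n → ℤ} :
    realVec (extend w 1) ∈ coneOver Ξ ↔ realVec w ∈ Ξ := by
  have hbase : realVec (extend w 1) ∘ Sum.inl = realVec w := rfl
  have hheight : realVec (extend w 1) (Sum.inr ()) = 1 := Int.cast_one
  simp [coneOver, hbase, hheight]

theorem exists_cone_eq_coneOver {v : P.Vertex} {x : P.TotalSpace} (hx : x ∈ P.component v) :
    ∃ Ξ ∈ P.cells, x.cone = coneOver Ξ ∧ realVec v.1 ∈ Ξ := by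
  obtain ⟨Ξ, hΞ, hcone | hcone⟩ := x.cone_mem
  · exact ⟨Ξ, hΞ, hcone, realVec_extend_one_mem_coneOver.1 (hcone ▸ hx)⟩
  · have hheight : ((1 : ℤ) : ℝ) = 0 := (hcone ▸ hx : realVec (extend v.1 1) ∈ coneAtInfinity Ξ).1
    exact absurd hheight (by norm_num)

theorem sub_realVec_mem_projAlong_image (v : P.Vertex) {Ξ : Set (Fin n → ℝ)} {x : Fin n → ℝ}
    (hx : x ∈ Ξ) : x - realVec v.1 ∈ P.projAlong v '' coneOver Ξ :=
  ⟨Sum.elim x fun _ => 1, Or.inl ⟨one_pos, by simpa using hx⟩, by simp [projAlong]⟩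

theorem emanates_of_projAlong_image_eq_rayCone {v : P.Vertex} {Ξ : Set (Fin n → ℝ)}
    {u : Fin n → ℤ} (hv : realVec v.1 ∈ Ξ) (h : P.projAlong v '' coneOver Ξ = rayCone u) :
    Emanates Ξ (realVec v.1) (realVec u) := by
  refine ⟨hv, fun x hx => ?_, ?_⟩
  · obtain ⟨t, ht, hxt⟩ : x - realVec v.1 ∈ rayCone u := h ▸ sub_realVec_mem_projAlong_image v hx
    exact ⟨t, ht, sub_eq_iff_eq_add'.1 hxt⟩
  · obtain ⟨z, hz, hzu⟩ : realVec u ∈ P.projAlong v '' coneOver Ξ :=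
      h ▸ ⟨1, zero_le_one, (one_smul _ _).symm⟩
    rw [← hzu, projAlong]
    rcases hz with ⟨hpos, hz⟩ | ⟨hzero, hz⟩
    · refine ⟨(z (Sum.inr ()))⁻¹, inv_pos.2 hpos, ?_⟩
      rwa [smul_sub, inv_smul_smul₀ hpos.ne', add_sub_cancel]
    · refine ⟨1, one_pos, ?_⟩
      rw [hzero, zero_smul, sub_zero]
      exact hz _ hv 1 zero_le_one

theorem sub_mem_toToric_cone {v w : P.Vertex} {x : P.component v} (hw : x.1 ∈ P.component w) :
    realVec w.1 - realVec v.1 ∈ (P.toToric v x).cone := by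
  refine ⟨realVec (extend w.1 1), hw, ?_⟩
  have hheight : realVec (extend w.1 1) (Sum.inr ()) = 1 := Int.cast_one
  rw [projAlong, hheight, one_smul]
  rfl

theorem exists_component_ne_of_mem_singularLocus {x : P.TotalSpace} (hx : x ∈ P.singularLocus)
    (v : P.Vertex) : ∃ w ≠ v, x ∈ P.component w := by
  obtain ⟨w, w', hne, hw, hw'⟩ := hx
  by_cases h : w = v
  · exact ⟨w', fun h' => hne (h.trans h'.symm), hw'⟩
  · exact ⟨w, h, hw⟩

/-- The big torus of the total space acts on each component of the central fiber. -/
instance (v : P.Vertex) : SMul (Torus (Fin n ⊕ Unit)) (P.component v) where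
  smul t x := ⟨t • x.1, x.2⟩

/-- The embedding `m ↦ (m, - ⟨m, v⟩)` of the character lattice of the torus of `X_v` into that of
the total space. -/
def componentCharacter (v : P.Vertex) : (Fin n → ℤ) →+ (Fin n ⊕ Unit → ℤ) where
  toFun m := extend m (-∑ i, m i * v.1 i)
  map_zero' := by
    ext (i | i) <;> simp [extend]
  map_add' m m' := by
    ext (i | i)
    · rfl
    · simp [extend, add_mul, Finset.sum_add_distrib, add_comm]

theorem toToric_smul (v : P.Vertex) (t : Torus (Fin n ⊕ Unit)) (x : P.component v) :
    P.toToric v (t • x) = t.compAddMonoidHom (componentCharacter v) • P.toToric v x :=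
  rfl

/-- The one-parameter subgroup of `(v, 1)` acts trivially on `X_v`, so the last coordinate of the
logarithm of a torus element can be made to vanish. -/
theorem exists_exp_smul_eq_of_cone_eq {v : P.Vertex} {x y : P.TotalSpace}
    (hx : x ∈ P.component v) (h : x.cone = y.cone) :
    ∃ b : Fin n → ℂ, Torus.exp (Sum.elim b 0 : Fin n ⊕ Unit → ℂ) • y = x := by
  obtain ⟨t, ht⟩ := ToricVariety.exists_smul_eq_of_cone_eq h
  obtain ⟨B, rfl⟩ := Torus.exp_surjective t
  let b : Fin n → ℂ := fun i => B (Sum.inl i) - B (Sum.inr ()) * v.1 i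
  have hB : B = Sum.elim b 0 + B (Sum.inr ()) • (Int.cast ∘ extend v.1 1) := by
    ext (i | i) <;> simp [b, extend]
  have hy : realVec (extend v.1 1) ∈ Submodule.span ℝ y.cone := Submodule.subset_span (h ▸ hx)
  rw [hB, Torus.exp_add, mul_smul, ToricVariety.exp_smul_eq_self hy] at ht
  exact ⟨b, ht⟩

end PolyhedralDecomposition

/-! ### Matching the curves along the bounded edges -/

namespace Respects

variable {n : ℕ} {P : PolyhedralDecomposition n} {T : TropicalCurve n} (R : Respects P T)

theorem exists_vertex_tgt_eq (E : T.B) : ∃ l : ℝ, 0 < l ∧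
    realVec (R.vertex (T.tgt E)).1 =
      realVec (R.vertex (T.src E)).1 + l • realVec (T.dirB E) := by
  obtain ⟨l, hl, h⟩ := T.edge E
  refine ⟨R.scale * l, mul_pos (Nat.cast_pos.2 R.scale_pos) (Rat.cast_pos.2 hl), ?_⟩
  rw [R.vertex_eq, R.vertex_eq]
  ext i
  simp only [TropicalCurve.posR, h, Pi.smul_apply, Pi.add_apply, smul_eq_mul, realVec]
  push_cast
  ring

theorem vertex_src_ne_tgt (E : T.B) : R.vertex (T.src E) ≠ R.vertex (T.tgt E) := fun h => by
  obtain ⟨l, hl, heq⟩ := R.exists_vertex_tgt_eq E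
  rw [h, left_eq_add] at heq
  exact smul_ne_zero hl.ne' (T.dirB_primitive E).realVec_ne_zero heq

theorem segment_emanates_src (E : T.B) :
    Emanates (segment ℝ (realVec (R.vertex (T.src E)).1) (realVec (R.vertex (T.tgt E)).1))
      (realVec (R.vertex (T.src E)).1) (realVec (T.dirB E)) := by
  obtain ⟨l, hl, h⟩ := R.exists_vertex_tgt_eq E
  rw [h]
  exact emanates_segment _ _ hl

theorem segment_emanates_tgt (E : T.B) :
    Emanates (segment ℝ (realVec (R.vertex (T.src E)).1) (realVec (R.vertex (T.tgt E)).1))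
      (realVec (R.vertex (T.tgt E)).1) (realVec (-T.dirB E)) := by
  obtain ⟨l, hl, h⟩ := R.exists_vertex_tgt_eq E
  have hneg : realVec (-T.dirB E) = -realVec (T.dirB E) := funext fun _ => Int.cast_neg _
  have h' : realVec (R.vertex (T.src E)).1 =
      realVec (R.vertex (T.tgt E)).1 + l • realVec (-T.dirB E) := by
    rw [h, hneg, smul_neg, add_neg_cancel_right]
  rw [segment_symm, h']
  exact emanates_segment _ _ hl

theorem realVec_extend_dirB_mem_span (E : T.B) {κ : Set (Fin n ⊕ Unit → ℝ)}
    (hsrc : realVec (extend (R.vertex (T.src E)).1 1) ∈ κ)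
    (htgt : realVec (extend (R.vertex (T.tgt E)).1 1) ∈ κ) :
    realVec (extend (T.dirB E) 0) ∈ Submodule.span ℝ κ := by
  obtain ⟨l, hl, h⟩ := R.exists_vertex_tgt_eq E
  have hdiff : l • realVec (extend (T.dirB E) 0) =
      realVec (extend (R.vertex (T.tgt E)).1 1) - realVec (extend (R.vertex (T.src E)).1 1) := by
    ext (i | i)
    · exact (sub_eq_of_eq_add' (congrFun h i)).symm
    · simp [realVec, extend]
  rw [← Submodule.smul_mem_iff _ hl.ne', hdiff]
  exact sub_mem (Submodule.subset_span htgt) (Submodule.subset_span hsrc)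

theorem exists_torus_smul_eq (hT : T.IsNonSuperabundant) {x y : T.B → P.TotalSpace}
    (hx : ∀ E, x E ∈ P.component (R.vertex (T.src E)))
    (hy : ∀ E, y E ∈ P.component (R.vertex (T.tgt E)))
    (hxy : ∀ E, (x E).cone = (y E).cone) :
    ∃ t : T.V → Torus (Fin n ⊕ Unit), ∀ E, t (T.src E) • x E = t (T.tgt E) • y E := by
  choose b hb using fun E =>
    PolyhedralDecomposition.exists_exp_smul_eq_of_cone_eq (hx E) (hxy E)
  obtain ⟨a, l, ha⟩ := hT.exists_sub_eq_add_smul b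
  refine ⟨fun v => Torus.exp (Sum.elim (a v) 0 : Fin n ⊕ Unit → ℂ), fun E => ?_⟩
  have hdir : realVec (extend (T.dirB E) 0) ∈ Submodule.span ℝ (y E).cone :=
    R.realVec_extend_dirB_mem_span E (hxy E ▸ hx E) (hy E)
  have htgt : (Sum.elim (a (T.tgt E)) 0 : Fin n ⊕ Unit → ℂ) =
      Sum.elim (a (T.src E)) 0 + Sum.elim (b E) 0 + l E • (Int.cast ∘ extend (T.dirB E) 0) := by
    ext (i | i)
    · simpa [extend, add_assoc, add_comm, add_left_comm]
        using sub_eq_iff_eq_add.1 (congrFun (ha E) i)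
    · simp [extend]
  dsimp only
  rw [htgt, Torus.exp_add, Torus.exp_add, mul_smul, mul_smul,
    ToricVariety.exp_smul_eq_self hdir, hb]

end Respects

namespace IsOfTypeAt

variable {n : ℕ} {P : PolyhedralDecomposition n} {T : TropicalCurve n} {R : Respects P T}
  {v : T.V} {f : P1 → P.component (R.vertex v)} {mark : T.FlagAt v → P1}

theorem smul (h : IsOfTypeAt R v f mark) (t : Torus (Fin n ⊕ Unit)) :
    IsOfTypeAt R v (fun q => t • f q) mark := by
  simp only [IsOfTypeAt, PolyhedralDecomposition.toToric_smul]
  exact IsOfVertexType.smul h _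

theorem cone_mark (h : IsOfTypeAt R v f mark) (e : T.FlagAt v) {Ξ : Set (Fin n → ℝ)}
    (hΞ : Ξ ∈ P.cells) (hem : Emanates Ξ (realVec (R.vertex v).1) (realVec (T.flagDir e.1))) :
    (f (mark e)).1.cone = coneOver Ξ := by
  obtain ⟨Ξ', hΞ', hcone, hv⟩ :=
    PolyhedralDecomposition.exists_cone_eq_coneOver (f (mark e)).2
  have hray : P.projAlong (R.vertex v) '' coneOver Ξ' = rayCone (T.flagDir e.1) :=
    hcone ▸ (h.meets e).2.1
  have hem' := PolyhedralDecomposition.emanates_of_projAlong_image_eq_rayCone hv hray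
  rw [hcone, PolyhedralDecomposition.cell_eq_of_emanates hΞ' hΞ hem' hem]

theorem exists_bounded_of_mem_component (h : IsOfTypeAt R v f mark) {q : P1} {w : P.Vertex}
    (hw : (f q).1 ∈ P.component w) (hne : w ≠ R.vertex v) :
    ∃ (E : T.B) (b : Bool) (hE : T.flagVertex (Sum.inl (E, b)) = v),
      mark ⟨Sum.inl (E, b), hE⟩ = q := by
  have hsub := PolyhedralDecomposition.sub_mem_toToric_cone hw
  by_cases hq : q ∈ Set.range mark
  · obtain ⟨⟨⟨E, b⟩ | E, rfl⟩, rfl⟩ := hq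
    · exact ⟨E, b, rfl, rfl⟩
    · have hcell : halfLine (realVec (R.vertex (T.base E)).1) (realVec (T.dirU E)) ∈ P.cells :=
        R.edgeU_mem E
      obtain ⟨t, ht, heq⟩ : _ ∈ rayCone (T.dirU E) := (h.meets ⟨Sum.inr E, rfl⟩).2.1 ▸ hsub
      have hext := w.mem_extremePoints hcell ⟨t, ht, sub_eq_iff_eq_add'.1 heq⟩
      exact absurd
        (Subtype.ext (realVec_injective (extremePoints_halfLine_subset _ _ hext))) hne
  · rw [h.only q hq, Set.mem_singleton_iff, sub_eq_zero] at hsub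
    exact absurd (Subtype.ext (realVec_injective hsub)) hne

end IsOfTypeAt

/-! ### Gluing -/

namespace WeightedGraph

variable (G : WeightedGraph)

/-- The prestable curve with dual graph `G` which is obtained from one Riemann sphere for each
vertex by gluing, for each bounded edge, the marked points of its two flags. -/
def gluedCurve (hG : G.IsConnected) (mark : (v : G.V) → G.FlagAt v → P1)
    (hmark : ∀ v, Function.Injective (mark v)) : PrestableCurve where
  comp := G.V
  node := G.B
  finComp := inferInstance
  finNode := inferInstance
  branch E b := (G.flagVertex (Sum.inl (E, b)), mark _ ⟨Sum.inl (E, b), rfl⟩)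
  branch_injective := by
    rintro ⟨E, b⟩ ⟨E', b'⟩ h
    obtain ⟨hvertex, hpoint⟩ := Prod.mk.inj h
    have transport : ∀ {v} (hv : G.flagVertex (Sum.inl (E', b')) = v),
        mark _ ⟨Sum.inl (E', b'), rfl⟩ = mark v ⟨Sum.inl (E', b'), hv⟩ := by
      rintro _ rfl
      rfl
    have hflag := hmark _ (hpoint.trans (transport hvertex.symm))
    exact Sum.inl_injective (congrArg Subtype.val hflag)
  nonempty := hG.1
  connected := hG.2

end WeightedGraph

section

variable {n : ℕ} {P : PolyhedralDecomposition n} {T : TropicalCurve n} {R : Respects P T}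

/-- The pre-log curve obtained by gluing curves of vertex type which agree at the marked points of
the bounded edges. -/
def gluedPreLogCurve (f : (v : T.V) → P1 → P.component (R.vertex v))
    (mark : (v : T.V) → T.FlagAt v → P1) (hf : ∀ v, IsOfTypeAt R v (f v) (mark v))
    (hglue : ∀ E, (f (T.src E) (mark (T.src E) ⟨Sum.inl (E, false), rfl⟩)).1 =
      (f (T.tgt E) (mark (T.tgt E) ⟨Sum.inl (E, true), rfl⟩)).1) : PreLogCurve P where
  toPrestableCurve := T.gluedCurve T.connected mark fun v => (hf v).injective
  vertex := R.vertex
  map := f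
  glue := hglue
  stable := by
    rintro v ⟨x, hx⟩
    obtain ⟨q, q', h⟩ := (hf v).nonconstant
    exact absurd (by rw [hx, hx]) h
  transverse v := (hf v).transverse
  node_of_singular v q hq := by
    obtain ⟨w, hne, hw⟩ :=
      PolyhedralDecomposition.exists_component_ne_of_mem_singularLocus hq (R.vertex v)
    obtain ⟨E, b, rfl, rfl⟩ := (hf v).exists_bounded_of_mem_component hw hne
    exact ⟨E, b, rfl⟩
  node_condition E _ := ⟨R.vertex_src_ne_tgt E, T.weightB E, T.dirB E, -T.dirB E,
    (hf (T.src E)).meets ⟨Sum.inl (E, false), rfl⟩, (hf (T.tgt E)).meets ⟨Sum.inl (E, true), rfl⟩⟩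

/-- The glued pre-log curve is of type `(Γ, h)`, with the given maps and marked points. -/
def gluedPreLogCurveOfType (f : (v : T.V) → P1 → P.component (R.vertex v))
    (mark : (v : T.V) → T.FlagAt v → P1) (hf : ∀ v, IsOfTypeAt R v (f v) (mark v))
    (hglue : ∀ E, (f (T.src E) (mark (T.src E) ⟨Sum.inl (E, false), rfl⟩)).1 =
      (f (T.tgt E) (mark (T.tgt E) ⟨Sum.inl (E, true), rfl⟩)).1) :
    (gluedPreLogCurve f mark hf hglue).OfType R where
  comp := Equiv.refl _
  node := Equiv.refl _
  mark := mark
  map := f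
  vertex_eq _ := rfl
  map_eq _ _ := rfl
  type := hf
  node_eq _ := rfl

end

end TropicalPreLog

theorem proposition5p24_general {n : ℕ} {T : TropicalCurve n} (hT : T.IsNonSuperabundant)
    {P : PolyhedralDecomposition n} {R : Respects P T}
    {C : (v : T.V) → P1 → P.component (R.vertex v)} {mark : (v : T.V) → T.FlagAt v → P1}
    (hC : ∀ v, IsOfTypeAt R v (C v) (mark v)) :
    ∃ (φ : PreLogCurve P) (τ : φ.OfType R), τ.mark = mark ∧
      ∀ v, ∃ t : Torus (Fin n ⊕ Unit), ∀ q, τ.map v q = t • C v q := by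
  let x (E : T.B) := C (T.src E) (mark (T.src E) ⟨Sum.inl (E, false), rfl⟩)
  let y (E : T.B) := C (T.tgt E) (mark (T.tgt E) ⟨Sum.inl (E, true), rfl⟩)
  have hxy (E : T.B) : (x E).1.cone = (y E).1.cone :=
    ((hC _).cone_mark ⟨Sum.inl (E, false), rfl⟩ (R.edgeB_mem E)
      (R.segment_emanates_src E)).trans
    ((hC _).cone_mark ⟨Sum.inl (E, true), rfl⟩ (R.edgeB_mem E) (R.segment_emanates_tgt E)).symm
  obtain ⟨t, ht⟩ := R.exists_torus_smul_eq hT (fun E => (x E).2) (fun E => (y E).2) hxy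
  exact ⟨_, gluedPreLogCurveOfType (fun v q => t v • C v q) mark (fun v => (hC v).smul (t v)) ht,
    rfl, fun v => ⟨t v, fun _ => rfl⟩⟩

theorem proposition5p24 (n : ℕ) (hn : 2 ≤ n) (T : TropicalCurve n)
    (hemb : T.IsEmbedded) (hns : T.IsNonSuperabundant)
    (P : PolyhedralDecomposition n) (R : Respects P T)
    (C : (v : T.V) → P1 → P.component (R.vertex v))
    (mark : (v : T.V) → T.FlagAt v → P1)
    (hC : ∀ v, IsOfTypeAt R v (C v) (mark v)) :
    ∃ (φ : PreLogCurve P) (τ : φ.OfType R),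
      ∀ v, ∃ g : Matrix.GeneralLinearGroup (Fin 2) ℂ, ∀ e, g • mark v e = τ.mark v e := by
  obtain ⟨φ, τ, rfl, -⟩ := proposition5p24_general hns hC
  exact ⟨φ, τ, fun v => ⟨1, fun e => one_smul _ _⟩⟩
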